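/- Let $\mathcal A$ be an abelian category, where "subcategory" means a full additive subcategory closed under isomorphisms, and let $\mathcal W\subseteq\mathcal X$ be subcategories of $\mathcal A$. Assume that $\mathcal X$ is closed under direct summands, extensions and kernels of epimorphisms, and that $\mathcal W$ is closed under direct summands and kernels of epimorphisms. Assume that $\mathcal W$ is an injective cogenerator and a projective generator for $\mathcal X$; that is, $\operatorname{Ext}^{n}_{\mathcal A}(X,W)=0=\operatorname{Ext}^{n}_{\mathcal A}(W,X)$ for all $n\ge 1$, $X\in\mathcal X$, $W\in\mathcal W$, and for each $X\in\mathcal X$ there are exact sequences $0\to X\to W\to X'\to 0$ and $0\to X''\to W'\to X\to 0$ with $W,W'\in\mathcal W$ and $X',X''\in\mathcal X$. For a subcategory $\mathcal U$ of $\mathcal A$, a $\mathcal U$-resolution of $M$ is an exact sequence $\cdots\to U_1\to U_0\to M\to 0$ with all $U_n\in\mathcal U$; it is proper if it stays exact under $\operatorname{Hom}_{\mathcal A}(U',-)$ for every $U'\in\mathcal U$. The $\mathcal U$-projective dimension $\mathcal U\text{-}\mathrm{pd}(M)\in\{0,1,2,\dots,\infty\}$ is the infimum of the lengths $\sup\{n\ge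 0: U_n\neq 0\}$ of the $\mathcal U$-resolutions of $M$ (with $\sup\emptyset=0$ and $\inf\emptyset=\infty$). If $U$ is a proper $\mathcal U$-resolution of $M$, then $\operatorname{Ext}^i_{\mathcal U\mathcal A}(M,-)=H^i(\operatorname{Hom}_{\mathcal A}(U,-))$ for $i\ge 0$. Let $M$ be an object of $\mathcal A$ with $d=\mathcal X\text{-}\mathrm{pd}(M)<\infty$. Then $M$ has a proper $\mathcal X$-resolution and a proper $\mathcal W$-resolution. For any proper $\mathcal X$-resolution $P$ and any proper $\mathcal W$-resolution $Q$ of $M$ there is a chain map $Q\to P$ lifting $\mathrm{id}_M$. For every such $P$, $Q$ and chain map, with $\vartheta^i:\operatorname{Ext}^i_{\mathcal X\mathcal A}(M,-)\to\operatorname{Ext}^i_{\mathcal W\mathcal A}(M,-)$ the induced natural transformation, the following conditions are equivalent: (i) $\mathcal W\text{-}\mathrm{pd}(M)<\infty$; (ii) $\vartheta^i$ is an isomorphism for every $i\ge 0$; (iii) $\vartheta^i$ and $\vartheta^{i+1}$ are isomorphisms for some $i$ with $1\le i$ and $i+1<d$, or $\vartheta^i$ is an isomorphism for a single $i$ with $i\ge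 1$ and $i\ge d$. -/

import Mathlib

open CategoryTheory CategoryTheory.Limits Opposite

universe v u

namespace RelHom

noncomputable section

section Subcategories

variable {C : Type u} [Category.{v} C] [Abelian C]

/-- `P` is (the class of objects of) a full additive subcategory closed under isomorphisms. -/
structure IsSubcategory (P : ObjectProperty C) : Prop where
  isoClosed : P.IsClosedUnderIsomorphisms
  zero : P.ContainsZero
  biprod : ∀ A B : C, P A → P B → P (A ⊞ B)

/-- Closure under direct summands: a direct summand of `B` is an object `A` with morphisms
`A ⟶ B ⟶ A` composing to the identity. -/
def ClosedUnderSummands (P : ObjectProperty C) : Prop :=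
  P.IsStableUnderRetracts

/-- An exact subcategory: closed under direct summands and extensions. -/
structure IsExactSubcategory (P : ObjectProperty C) : Prop where
  summands : ClosedUnderSummands P
  extensions : P.IsClosedUnderExtensions

/-- Closure under kernels of epimorphisms between objects of the subcategory. -/
def ClosedUnderKernelsOfEpis (P : ObjectProperty C) : Prop :=
  ∀ S : ShortComplex C, S.ShortExact → P S.X₂ → P S.X₃ → P S.X₁

/-- `P ⊥ Q`: the (Yoneda) groups `Ext^n(A, B)` vanish for all `A` in `P`, `B` in `Q`, `n ≥ 1`.
The `Ext` groups exist in every abelian category, in the universe `max u v`. -/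
def Perp (P Q : ObjectProperty C) : Prop :=
  letI : HasExt.{max u v} C := HasExt.standard C
  ∀ A B : C, P A → Q B → ∀ n : ℕ, 1 ≤ n → Subsingleton (Abelian.Ext.{max u v} A B n)

/-- Every `A` in `X` sits in a short exact sequence `0 ⟶ A ⟶ B ⟶ A' ⟶ 0`
with `B` in `W` and `A'` in `X`. -/
def IsCogeneratorFor (W X : ObjectProperty C) : Prop :=
  ∀ A : C, X A → ∃ (B A' : C) (i : A ⟶ B) (p : B ⟶ A') (w : i ≫ p = 0),
    (ShortComplex.mk i p w).ShortExact ∧ W B ∧ X A'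

/-- Every `A` in `X` sits in a short exact sequence `0 ⟶ A' ⟶ B ⟶ A ⟶ 0`
with `B` in `W` and `A'` in `X`. -/
def IsGeneratorFor (W X : ObjectProperty C) : Prop :=
  ∀ A : C, X A → ∃ (B A' : C) (i : A' ⟶ B) (p : B ⟶ A) (w : i ≫ p = 0),
    (ShortComplex.mk i p w).ShortExact ∧ W B ∧ X A'

structure IsInjectiveCogeneratorFor (W X : ObjectProperty C) : Prop where
  cogenerator : IsCogeneratorFor W X
  perp : Perp X W

structure IsProjectiveGeneratorFor (W X : ObjectProperty C) : Prop where
  generator : IsGeneratorFor W X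
  perp : Perp W X

end Subcategories

section Resolutions

variable {C : Type u} [Category.{v} C] [Abelian C]

/-- An `X`-resolution of `M`: a complex `⋯ ⟶ X₁ ⟶ X₀` of objects of `X` with an augmentation
`X₀ ⟶ M` such that the augmented complex `⋯ ⟶ X₁ ⟶ X₀ ⟶ M ⟶ 0` is exact. -/
structure Resolution (X : ObjectProperty C) (M : C) where
  complex : ChainComplex C ℕ
  mem : ∀ n, X (complex.X n)
  ε : complex.X 0 ⟶ M
  w : complex.d 1 0 ≫ ε = 0
  exact : (complex.augment ε w).Acyclic

/-- The augmented resolution. -/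
def Resolution.augmented {X : ObjectProperty C} {M : C} (R : Resolution X M) :
    ChainComplex C ℕ :=
  R.complex.augment R.ε R.w

/-- A resolution is proper if its augmented complex is `Hom(A, -)`-exact for all `A` in `X`. -/
def Resolution.IsProper {X : ObjectProperty C} {M : C} (R : Resolution X M) : Prop :=
  ∀ A : C, X A → (((preadditiveCoyoneda.obj (op A)).mapHomologicalComplex
    (ComplexShape.down ℕ)).obj R.augmented).Acyclic

/-- The length `sup {n ≥ 0 | Xₙ ≠ 0}` of a resolution (it is `0` for the zero complex). -/
def Resolution.length {X : ObjectProperty C} {M : C} (R : Resolution X M) : ℕ∞ :=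
  ⨆ (n : ℕ) (_ : ¬ IsZero (R.complex.X n)), (n : ℕ∞)

/-- The `X`-projective dimension: the infimum of the lengths of all `X`-resolutions;
it is `⊤` if there is none. -/
def projDim (X : ObjectProperty C) (M : C) : ℕ∞ :=
  ⨅ R : Resolution X M, R.length

/-- A morphism of complexes lifting the identity of the resolved object. -/
structure Lift {W X : ObjectProperty C} {M : C} (Q : Resolution W M) (P : Resolution X M) where
  hom : Q.complex ⟶ P.complex
  comm : hom.f 0 ≫ P.ε = Q.ε

end Resolutions

section RelativeExt

variable {C : Type u} [Category.{v} C] [Abelian C]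

/-- The complex of abelian groups `Hom(P, N)`, with `Hom(Pₙ, N)` in cohomological degree `n`,
as a functor of `N`. -/
def homComplex (P : ChainComplex C ℕ) :
    C ⥤ HomologicalComplex AddCommGrpCat.{v} (ComplexShape.down ℕ).symm where
  obj N := ((preadditiveYoneda.obj N).mapHomologicalComplex _).obj P.op
  map g := (NatTrans.mapHomologicalComplex (preadditiveYoneda.map g) _).app P.op

/-- Precomposition `Hom(P, -) ⟶ Hom(Q, -)` with a morphism of complexes `Q ⟶ P`. -/
def homComplexMap {Q P : ChainComplex C ℕ} (φ : Q ⟶ P) : homComplex P ⟶ homComplex Q where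
  app N := ((preadditiveYoneda.obj N).mapHomologicalComplex _).map
    ((HomologicalComplex.opFunctor C (ComplexShape.down ℕ)).map φ.op)
  naturality _ _ g :=
    ((NatTrans.mapHomologicalComplex (preadditiveYoneda.map g) _).naturality _).symm

/-- The relative cohomology functor `Ext_X^n(M, -)`, computed from a (proper) `X`-resolution
of `M`: the `n`th cohomology of `Hom(P, -)`. -/
def relExt {X : ObjectProperty C} {M : C} (P : Resolution X M) (n : ℕ) : C ⥤ AddCommGrpCat.{v} :=
  homComplex P.complex ⋙ HomologicalComplex.homologyFunctor _ _ n

/-- The comparison transformation `Ext_X^n(M, -) ⟶ Ext_W^n(M, -)`, induced by a lift of `id_M`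
from a (proper) `W`-resolution to a (proper) `X`-resolution. -/
def comparison {W X : ObjectProperty C} {M : C} {Q : Resolution W M} {P : Resolution X M}
    (φ : Lift Q P) (n : ℕ) : relExt P n ⟶ relExt Q n :=
  Functor.whiskerRight (homComplexMap φ.hom) (HomologicalComplex.homologyFunctor _ _ n)

end RelativeExt

end

end RelHom

/-! The implication (i) ⇒ (ii) is a comparison argument. Vanishing of Ext from `X` to `W` passes to
objects with finite `W`-resolutions by dimension shifting (`Perp.hat`), so such an `M` has a
`W`-resolution `R` that is `Hom(A, -)`-exact for every `A` in `X`. Hence there are lifts `P ⟶ R ⟶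
Q`; their composite is a homotopy inverse of the given `Q ⟶ P`, and all comparison maps are
isomorphisms.

For (iii) ⇒ (i), Auslander–Buchweitz approximation provides a proper `X`-resolution `P'` of length
at most `d` with all terms except possibly `P'₀` in `W` (`exists_special_resolution`). Replacing `P`
by `P'` changes the comparison maps by isomorphisms only. The cone of `Q ⟶ P'` is exact, with `P'₀`
in degree 0 and `Qₙ ⊞ P'ₙ₊₁`, an object of `W`, in degree `n + 1`. If `ϑⁱ` is epi and either `ϑⁱ⁺¹`
is mono or `P'ᵢ₊₁ = 0`, the cone is `Hom(-, N)`-exact in degree `i + 1` for every `N`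
(`exists_eq_cone_d_comp`). It therefore splits there, and one syzygy lies in `W`. As `Ext¹(X, W) =
0`, the syzygy sequences below split too, so `P'₀` lies in `W` (`prop_of_acyclic`) and `P'` is a
finite `W`-resolution. -/

namespace RelHom

/-! ### Short exact sequences, pushouts and pullbacks -/

section ShortExactSequences

variable {C : Type u} [Category.{v} C] [Abelian C]

/-- The morphisms `i` and `p` form a short exact sequence `0 ⟶ A ⟶ B ⟶ D ⟶ 0`. -/
def IsShortExact {A B D : C} (i : A ⟶ B) (p : B ⟶ D) : Prop :=
  ∃ w : i ≫ p = 0, (ShortComplex.mk i p w).ShortExact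

namespace IsShortExact

variable {A B D : C} {i : A ⟶ B} {p : B ⟶ D}

lemma zero (h : IsShortExact i p) : i ≫ p = 0 := h.1

lemma mono (h : IsShortExact i p) : Mono i := h.2.mono_f

lemma epi (h : IsShortExact i p) : Epi p := h.2.epi_g

lemma exists_desc (h : IsShortExact i p) {T : C} (f : B ⟶ T) (hf : i ≫ f = 0) :
    ∃ l : D ⟶ T, p ≫ l = f :=
  have := h.epi
  ⟨h.2.exact.desc f hf, h.2.exact.g_desc f hf⟩

lemma exists_lift (h : IsShortExact i p) {T : C} (f : T ⟶ B) (hf : f ≫ p = 0) :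
    ∃ l : T ⟶ A, l ≫ i = f :=
  have := h.mono
  ⟨h.2.exact.lift f hf, h.2.exact.lift_f f hf⟩

lemma of_desc (hi : Mono i) (hp : Epi p) (w : i ≫ p = 0)
    (h : ∀ (T : C) (f : B ⟶ T), i ≫ f = 0 → ∃ l : D ⟶ T, p ≫ l = f) : IsShortExact i p := by
  refine ⟨w, ⟨ShortComplex.exact_of_g_is_cokernel _ ?_⟩⟩
  exact CokernelCofork.IsColimit.ofπ' p w fun k hk => ⟨(h _ k hk).choose, (h _ k hk).choose_spec⟩

lemma of_lift (hi : Mono i) (hp : Epi p) (w : i ≫ p = 0)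
    (h : ∀ (T : C) (f : T ⟶ B), f ≫ p = 0 → ∃ l : T ⟶ A, l ≫ i = f) : IsShortExact i p := by
  refine ⟨w, ⟨ShortComplex.exact_of_f_is_kernel _ ?_⟩⟩
  exact KernelFork.IsLimit.ofι' i w fun k hk => ⟨(h _ k hk).choose, (h _ k hk).choose_spec⟩

lemma zero_id (Z A : C) (hZ : IsZero Z) : IsShortExact (0 : Z ⟶ A) (𝟙 A) :=
  of_lift ⟨fun _ _ _ => hZ.eq_of_tgt _ _⟩ inferInstance zero_comp
    fun T f hf => ⟨0, by simpa using hf.symm⟩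

lemma comp_iso (h : IsShortExact i p) {D' : C} (e : D ≅ D') : IsShortExact i (p ≫ e.hom) := by
  have := h.mono
  have := h.epi
  refine of_desc inferInstance inferInstance (by simp [reassoc_of% h.zero]) fun T f hf => ?_
  obtain ⟨l, hl⟩ := h.exists_desc f hf
  exact ⟨e.inv ≫ l, by simp [hl]⟩

/-- The pushout of a short exact sequence along a monomorphism. -/
lemma exists_pushout (h : IsShortExact i p) {H Y : C} {j : A ⟶ H} {q : H ⟶ Y}
    (h' : IsShortExact j q) :
    ∃ (E : C) (a : H ⟶ E) (b : E ⟶ D) (c : B ⟶ E) (e : E ⟶ Y),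
      IsShortExact a b ∧ IsShortExact c e := by
  have := h.mono
  have := h.epi
  have := h'.mono
  have := h'.epi
  refine ⟨pushout i j, pushout.inr i j, pushout.desc p 0 (by simp [h.zero]), pushout.inl i j,
    pushout.desc 0 q (by simp [h'.zero]), of_desc inferInstance ?_ (pushout.inr_desc _ _ _) ?_,
    of_desc inferInstance ?_ (pushout.inl_desc _ _ _) ?_⟩
  · exact epi_of_epi_fac (pushout.inl_desc p 0 (by simp [h.zero]))
  · intro T f hf
    obtain ⟨l, hl⟩ := h.exists_desc (pushout.inl i j ≫ f) (by
      rw [pushout.condition_assoc, hf, comp_zero])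
    exact ⟨l, by ext <;> simp [hl, hf, pushout.inl_desc_assoc, pushout.inr_desc_assoc]⟩
  · exact epi_of_epi_fac (pushout.inr_desc 0 q (by simp [h'.zero]))
  · intro T f hf
    obtain ⟨l, hl⟩ := h'.exists_desc (pushout.inr i j ≫ f) (by
      rw [← pushout.condition_assoc, hf, comp_zero])
    exact ⟨l, by ext <;> simp [hl, hf, pushout.inl_desc_assoc, pushout.inr_desc_assoc]⟩

/-- The pullback of a short exact sequence along an epimorphism. -/
lemma exists_pullback (h : IsShortExact i p) {K R : C} {j : K ⟶ R} {q : R ⟶ D}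
    (h' : IsShortExact j q) :
    ∃ (E : C) (a : A ⟶ E) (b : E ⟶ R) (c : K ⟶ E) (e : E ⟶ B),
      IsShortExact a b ∧ IsShortExact c e := by
  have := h.mono
  have := h.epi
  have := h'.mono
  have := h'.epi
  refine ⟨pullback p q, pullback.lift i 0 (by simp [h.zero]), pullback.snd p q,
    pullback.lift 0 j (by simp [h'.zero]), pullback.fst p q,
    of_lift ?_ inferInstance (pullback.lift_snd _ _ _) ?_, of_lift ?_ inferInstance (pullback.lift_fst _ _ _) ?_⟩
  · exact mono_of_mono_fac (pullback.lift_fst i 0 (by simp [h.zero]))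
  · intro T f hf
    obtain ⟨l, hl⟩ := h.exists_lift (f ≫ pullback.fst p q) (by
      rw [Category.assoc, pullback.condition, reassoc_of% hf, zero_comp])
    exact ⟨l, by ext <;> simp [hl, hf, pullback.lift_fst, pullback.lift_snd]⟩
  · exact mono_of_mono_fac (pullback.lift_snd 0 j (by simp [h'.zero]))
  · intro T f hf
    obtain ⟨l, hl⟩ := h'.exists_lift (f ≫ pullback.snd p q) (by
      rw [Category.assoc, ← pullback.condition, reassoc_of% hf, zero_comp])
    exact ⟨l, by ext <;> simp [hl, hf, pullback.lift_fst, pullback.lift_snd]⟩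

/-- Embedding the middle term of a short exact sequence. -/
lemma exists_hull (h : IsShortExact i p) {V Y : C} {j : B ⟶ V} {q : V ⟶ Y}
    (h' : IsShortExact j q) :
    ∃ (E : C) (b : V ⟶ E) (c : D ⟶ E) (e : E ⟶ Y),
      IsShortExact (i ≫ j) b ∧ IsShortExact c e := by
  have := h.mono
  have := h.epi
  have := h'.mono
  have := h'.epi
  refine ⟨pushout p j, pushout.inr p j, pushout.inl p j,
    pushout.desc 0 q (by simp [h'.zero]), of_desc inferInstance inferInstance ?_ ?_,
    of_desc inferInstance ?_ (pushout.inl_desc _ _ _) ?_⟩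
  · rw [Category.assoc, ← pushout.condition, reassoc_of% h.zero, zero_comp]
  · intro T f hf
    obtain ⟨l, hl⟩ := h.exists_desc (j ≫ f) (by simpa using hf)
    exact ⟨pushout.desc l f hl, pushout.inr_desc _ _ _⟩
  · exact epi_of_epi_fac (pushout.inr_desc 0 q (by simp [h'.zero]))
  · intro T f hf
    obtain ⟨l, hl⟩ := h'.exists_desc (pushout.inr p j ≫ f) (by
      rw [← pushout.condition_assoc, hf, comp_zero])
    exact ⟨l, by ext <;> simp [hl, hf, pushout.inl_desc_assoc, pushout.inr_desc_assoc]⟩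

/-- Covering the middle term of a short exact sequence. -/
lemma exists_cover (h : IsShortExact i p) {V Y : C} {j : Y ⟶ V} {q : V ⟶ B}
    (h' : IsShortExact j q) :
    ∃ (E : C) (b : E ⟶ V) (c : Y ⟶ E) (e : E ⟶ A),
      IsShortExact b (q ≫ p) ∧ IsShortExact c e := by
  have := h.mono
  have := h.epi
  have := h'.mono
  have := h'.epi
  refine ⟨pullback i q, pullback.snd i q, pullback.lift 0 j (by simp [h'.zero]),
    pullback.fst i q, of_lift inferInstance inferInstance ?_ ?_,
    of_lift ?_ inferInstance (pullback.lift_fst _ _ _) ?_⟩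
  · rw [← pullback.condition_assoc, h.zero, comp_zero]
  · intro T f hf
    obtain ⟨l, hl⟩ := h.exists_lift (f ≫ q) (by simpa using hf)
    exact ⟨pullback.lift l f hl, pullback.lift_snd _ _ _⟩
  · exact mono_of_mono_fac (pullback.lift_snd 0 j (by simp [h'.zero]))
  · intro T f hf
    obtain ⟨l, hl⟩ := h'.exists_lift (f ≫ pullback.snd i q) (by
      rw [Category.assoc, ← pullback.condition, reassoc_of% hf, zero_comp])
    exact ⟨l, by ext <;> simp [hl, hf, pullback.lift_fst, pullback.lift_snd]⟩

end IsShortExact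

end ShortExactSequences

/-! ### Finite resolutions and Auslander–Buchweitz approximation -/

section FiniteResolutions

variable {C : Type u} [Category.{v} C] [Abelian C]

/-- The objects having a resolution of length at most `n` by objects of `U`. -/
def Hat (U : ObjectProperty C) : ℕ → ObjectProperty C
  | 0 => U
  | n + 1 => fun M => ∃ (K R : C) (i : K ⟶ R) (p : R ⟶ M), IsShortExact i p ∧ U R ∧ Hat U n K

lemma IsSubcategory.prop_of_isZero {U : ObjectProperty C} (hU : IsSubcategory U) {Z : C}
    (hZ : IsZero Z) : U Z := by
  have := hU.isoClosed
  obtain ⟨Z', hZ', h⟩ := hU.zero.exists_zero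
  exact U.prop_of_iso (hZ'.iso hZ) h

lemma Hat.of_iso {U : ObjectProperty C} (hU : IsSubcategory U) {n : ℕ} {M M' : C}
    (h : Hat U n M) (e : M ≅ M') : Hat U n M' := by
  cases n with
  | zero =>
    have := hU.isoClosed
    exact U.prop_of_iso e h
  | succ n =>
    obtain ⟨K, R, i, p, hS, hR, hK⟩ := h
    exact ⟨K, R, i, _, hS.comp_iso e, hR, hK⟩

lemma Hat.of_isZero {U : ObjectProperty C} (hU : IsSubcategory U) (n : ℕ) {Z : C}
    (hZ : IsZero Z) : Hat U n Z := by
  induction n with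
  | zero => exact hU.prop_of_isZero hZ
  | succ n ih => exact ⟨Z, Z, 0, 𝟙 Z, .zero_id _ _ hZ, hU.prop_of_isZero hZ, ih⟩

lemma Hat.of_prop {U : ObjectProperty C} (hU : IsSubcategory U) (n : ℕ) {M : C}
    (hM : U M) : Hat U n M := by
  cases n with
  | zero => exact hM
  | succ n => exact ⟨_, M, 0, 𝟙 M, .zero_id _ _ (isZero_zero C), hM,
      Hat.of_isZero hU n (isZero_zero C)⟩

lemma Hat.succ {U : ObjectProperty C} (hU : IsSubcategory U) {n : ℕ} {M : C}
    (h : Hat U n M) : Hat U (n + 1) M := by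
  induction n generalizing M with
  | zero => exact .of_prop hU 1 h
  | succ n ih =>
    obtain ⟨K, R, i, p, hS, hR, hK⟩ := h
    exact ⟨K, R, i, p, hS, hR, ih hK⟩

/-- Extensions of an object with a finite resolution by an object of `X` on the left. -/
lemma Hat.of_extension {X : ObjectProperty C} (hX : X.IsClosedUnderExtensions) {n : ℕ}
    {A B D : C} {i : A ⟶ B} {p : B ⟶ D} (h : IsShortExact i p) (hA : X A) (hD : Hat X n D) :
    Hat X n B := by
  cases n with
  | zero => exact X.prop_X₂_of_shortExact h.2 hA hD
  | succ n =>
    obtain ⟨K, R, j, q, hS, hR, hK⟩ := hD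
    -- The pullback of `B` and `R` over `D` is an extension of `R` by `A`, and maps onto `B` with
    -- the old kernel `K`.
    obtain ⟨E, a, b, c, e, h₁, h₂⟩ := h.exists_pullback hS
    exact ⟨K, E, c, e, h₂, X.prop_X₂_of_shortExact h₁.2 hA hR, hK⟩

/-- Every object `M` with a finite `X`-resolution embeds into an object with a finite
`W`-resolution, with cokernel in `X`, and is a quotient of an object of `X` by such an object. -/
lemma Hat.exists_hull_and_approximation {W X : ObjectProperty C}
    (hX : X.IsClosedUnderExtensions) (hW : IsCogeneratorFor W X) (n : ℕ) :
    (∀ M, Hat X n M → ∃ (H Y : C) (i : M ⟶ H) (p : H ⟶ Y),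
      IsShortExact i p ∧ Hat W n H ∧ X Y) ∧
    (∀ M, Hat X (n + 1) M → ∃ (K A : C) (i : K ⟶ A) (p : A ⟶ M),
      IsShortExact i p ∧ Hat W n K ∧ X A) := by
  have key : ∀ n : ℕ, (∀ M, Hat X n M → ∃ (H Y : C) (i : M ⟶ H) (p : H ⟶ Y),
      IsShortExact i p ∧ Hat W n H ∧ X Y) →
      (∀ M, Hat X (n + 1) M → ∃ (K A : C) (i : K ⟶ A) (p : A ⟶ M),
        IsShortExact i p ∧ Hat W n K ∧ X A) := by
    rintro n hn M ⟨K, R, i, p, hS, hR, hK⟩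
    obtain ⟨H, Y, j, q, hS', hH, hY⟩ := hn K hK
    -- Pushing out along the hull of the syzygy `K` replaces the kernel by `H` and the middle term
    -- by an extension of `Y` by `R`.
    obtain ⟨E, a, b, c, e, h₁, h₂⟩ := hS.exists_pushout hS'
    exact ⟨H, E, a, b, h₁, hH, X.prop_X₂_of_shortExact h₂.2 hR hY⟩
  suffices h : ∀ M, Hat X n M → ∃ (H Y : C) (i : M ⟶ H) (p : H ⟶ Y),
      IsShortExact i p ∧ Hat W n H ∧ X Y from ⟨h, key n h⟩
  induction n with
  | zero =>
    intro M hM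
    obtain ⟨B, A', i, p, w, hS, hB, hA⟩ := hW M hM
    exact ⟨B, A', i, p, ⟨w, hS⟩, hB, hA⟩
  | succ n ih =>
    intro M hM
    obtain ⟨K, A, i, p, hS, hK, hA⟩ := key n ih M hM
    obtain ⟨B, A', j, q, w, hS', hB, hA'⟩ := hW A hA
    obtain ⟨E, b, c, e, h₁, h₂⟩ := hS.exists_hull ⟨w, hS'⟩
    exact ⟨E, A', c, e, h₂, ⟨K, B, i ≫ j, b, h₁, hB, hK⟩, hA'⟩

/-- Every object with a finite `X`-resolution is covered by an object of `W`, the kernel having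
again a finite `X`-resolution. -/
lemma Hat.exists_cover {W X : ObjectProperty C} (hXs : IsSubcategory X)
    (hX : X.IsClosedUnderExtensions) (hW : IsGeneratorFor W X) {n : ℕ} {M : C}
    (hM : Hat X n M) :
    ∃ (L B : C) (i : L ⟶ B) (p : B ⟶ M), IsShortExact i p ∧ W B ∧ Hat X n L := by
  cases n with
  | zero =>
    obtain ⟨B, A', i, p, w, hS, hB, hA⟩ := hW M hM
    exact ⟨A', B, i, p, ⟨w, hS⟩, hB, hA⟩
  | succ n =>
    obtain ⟨K, R, i, p, hS, hR, hK⟩ := hM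
    obtain ⟨B, A', j, q, w, hS', hB, hA'⟩ := hW R hR
    obtain ⟨E, b, c, e, h₁, h₂⟩ := hS.exists_cover ⟨w, hS'⟩
    -- The new kernel `E` is an extension of `K` by `A'`. Its bound `n` is weakened to `n + 1`, the
    -- bound for `M`, so that the construction can be iterated.
    exact ⟨E, B, b, _, h₁, hB, (Hat.of_extension hX h₂ hA' hK).succ hXs⟩

end FiniteResolutions

/-! ### Vanishing of Ext and lifting -/

section ExtVanishing

variable {C : Type u} [Category.{v} C] [Abelian C]

/-- Dimension shifting: `Ext^m(A, B)` lies between `Ext^m(A, R)` and `Ext^(m+1)(A, K)` in the long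
exact sequence. -/
lemma Perp.hat {P Q : ObjectProperty C} (h : Perp P Q) (n : ℕ) : Perp P (Hat Q n) := by
  let _ : HasExt.{max u v} C := HasExt.standard C
  induction n with
  | zero => exact h
  | succ n ih =>
    rintro A B hA ⟨K, R, i, p, hS, hR, hK⟩ m hm
    refine subsingleton_of_forall_eq 0 fun x => ?_
    have : Subsingleton (Abelian.Ext.{max u v} A K (m + 1)) := ih A K hA hK (m + 1) (by lia)
    have : Subsingleton (Abelian.Ext.{max u v} A R m) := h A R hA hR m hm
    obtain ⟨y, hy⟩ := Abelian.Ext.covariant_sequence_exact₃ A hS.2 x rfl (Subsingleton.elim _ _)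
    rw [← hy, Subsingleton.elim y 0, Abelian.Ext.zero_comp]

/-- The obstruction to lifting `f` lies in `Ext¹(A, K)`. -/
lemma Perp.exists_lift {P Q : ObjectProperty C} (h : Perp P Q) {A K B D : C} {i : K ⟶ B}
    {p : B ⟶ D} (hS : IsShortExact i p) (hA : P A) (hK : Q K) (f : A ⟶ D) :
    ∃ g : A ⟶ B, g ≫ p = f := by
  let _ : HasExt.{max u v} C := HasExt.standard C
  have : Subsingleton (Abelian.Ext.{max u v} A K 1) := h A K hA hK 1 le_rfl
  obtain ⟨y, hy⟩ := Abelian.Ext.covariant_sequence_exact₃ A hS.2 (Abelian.Ext.mk₀ f) rfl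
    (Subsingleton.elim _ _)
  obtain ⟨g, rfl⟩ := (Abelian.Ext.mk₀_bijective _ _).2 y
  refine ⟨g, (Abelian.Ext.mk₀_bijective _ _).1 ?_⟩
  rw [← hy, Abelian.Ext.mk₀_comp_mk₀]

end ExtVanishing

end RelHom

namespace RelHom

/-! ### Relative exactness as a lifting property -/

section LiftExactness

variable {C : Type u} [Category.{v} C] [Abelian C]

/-- The complex `E` is `Hom(A, -)`-exact, in terms of liftings of morphisms. -/
structure LiftExact (E : ChainComplex C ℕ) (A : C) : Prop where
  zero : ∀ f : A ⟶ E.X 0, ∃ g : A ⟶ E.X 1, g ≫ E.d 1 0 = f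
  succ : ∀ (n : ℕ) (f : A ⟶ E.X (n + 1)), f ≫ E.d (n + 1) n = 0 →
    ∃ g : A ⟶ E.X (n + 2), g ≫ E.d (n + 2) (n + 1) = f

lemma acyclic_iff (E : ChainComplex C ℕ) :
    E.Acyclic ↔ Epi (E.d 1 0) ∧
      ∀ n : ℕ, (ShortComplex.mk (E.d (n + 2) (n + 1)) (E.d (n + 1) n) (by simp)).Exact := by
  have h₀ : E.ExactAt 0 ↔ Epi (E.d 1 0) := by
    rw [E.exactAt_iff' 1 0 0 (by simp) (by simp)]
    exact ShortComplex.exact_iff_epi _ (E.shape 0 0 (by simp))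
  have hs (n : ℕ) : E.ExactAt (n + 1) ↔
      (ShortComplex.mk (E.d (n + 2) (n + 1)) (E.d (n + 1) n) (by simp)).Exact := by
    rw [E.exactAt_iff' (n + 2) (n + 1) n (by simp) (by simp)]
    rfl
  refine ⟨fun h => ⟨h₀.1 (h 0), fun n => (hs n).1 (h (n + 1))⟩, fun h n => ?_⟩
  cases n with
  | zero => exact h₀.2 h.1
  | succ n => exact (hs n).2 (h.2 n)

lemma liftExact_iff (E : ChainComplex C ℕ) (A : C) :
    LiftExact E A ↔ (((preadditiveCoyoneda.obj (op A)).mapHomologicalComplex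
      (ComplexShape.down ℕ)).obj E).Acyclic := by
  rw [acyclic_iff, AddCommGrpCat.epi_iff_surjective]
  refine ⟨fun h => ⟨h.zero, fun n => ?_⟩, fun h => ⟨h.1, fun n => ?_⟩⟩
  · rw [ShortComplex.ab_exact_iff]
    exact h.succ n
  · have := h.2 n
    rw [ShortComplex.ab_exact_iff] at this
    exact this

lemma Resolution.isProper_iff {X : ObjectProperty C} {M : C} (R : Resolution X M) :
    R.IsProper ↔ ∀ A, X A → LiftExact R.augmented A :=
  forall₂_congr fun A _ => (liftExact_iff R.augmented A).symm

/-- Cuts an exact complex into its syzygy sequences, the images of the differentials serving as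
syzygies. -/
lemma isShortExact_of_acyclic {E : ChainComplex C ℕ} (hE : E.Acyclic) (n : ℕ) :
    IsShortExact (image.ι (E.d (n + 2) (n + 1))) (factorThruImage (E.d (n + 1) n)) := by
  refine .of_lift inferInstance inferInstance ?_ fun T f hf => ?_
  · rw [← cancel_mono (image.ι _), ← cancel_epi (factorThruImage _)]
    simp
  · have hex := ((acyclic_iff E).1 hE).2 n
    have hf' : f ≫ E.d (n + 1) n = 0 := by
      rw [← image.fac (E.d (n + 1) n), reassoc_of% hf, zero_comp]
    have hex' : (ShortComplex.mk (image.ι (E.d (n + 2) (n + 1))) (E.d (n + 1) n) (by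
        rw [← cancel_epi (factorThruImage _)]; simp)).Exact := by
      rw [ShortComplex.exact_iff_exact_up_to_refinements] at hex ⊢
      intro A x hx
      obtain ⟨A', π, hπ, y, hy⟩ := hex x hx
      exact ⟨A', π, hπ, y ≫ factorThruImage _, by simpa using hy⟩
    exact ⟨hex'.lift f hf', hex'.lift_f f hf'⟩

end LiftExactness

/-! ### Resolutions spliced from syzygies -/

section Syzygies

variable {C : Type u} [Category.{v} C] [Abelian C]

/-- The complex obtained by splicing short exact sequences `0 ⟶ Kₙ₊₁ ⟶ Rₙ ⟶ Kₙ ⟶ 0`. -/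
noncomputable def spliced {K R : ℕ → C} {i : ∀ n, K (n + 1) ⟶ R n} {p : ∀ n, R n ⟶ K n}
    (h : ∀ n, IsShortExact (i n) (p n)) : ChainComplex C ℕ :=
  ChainComplex.of R (fun n => p (n + 1) ≫ i n) fun n => by
    rw [Category.assoc, reassoc_of% (h (n + 1)).zero, zero_comp, comp_zero]

section

variable {K R : ℕ → C} {i : ∀ n, K (n + 1) ⟶ R n} {p : ∀ n, R n ⟶ K n}
  (h : ∀ n, IsShortExact (i n) (p n))

@[simp]
lemma spliced_d (n : ℕ) : (spliced h).d (n + 1) n = p (n + 1) ≫ i n :=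
  ChainComplex.of_d R (fun n => p (n + 1) ≫ i n) n

lemma spliced_d_comp : (spliced h).d 1 0 ≫ p 0 = 0 := by
  rw [spliced_d]
  exact (Category.assoc _ _ _).trans ((congrArg (p 1 ≫ ·) (h 0).zero).trans comp_zero)

include h in
lemma exists_lift_of_comp_eq_zero {A : C} {n : ℕ} (f : A ⟶ R (n + 1))
    (hf : f ≫ p (n + 1) ≫ i n = 0) : ∃ g, g ≫ i (n + 1) = f := by
  have := (h n).mono
  exact (h (n + 1)).exists_lift f (by rwa [← cancel_mono (i n), zero_comp, Category.assoc])

lemma acyclic_augment_spliced :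
    ((spliced h).augment (p 0) (spliced_d_comp h)).Acyclic := by
  have hp n : Epi (p n) := (h n).epi
  refine (acyclic_iff _).2 ⟨hp 0, fun n => ?_⟩
  rw [ShortComplex.exact_iff_exact_up_to_refinements]
  intro A f hf
  obtain ⟨g, rfl⟩ : ∃ g, g ≫ i n = f := by
    cases n with
    | zero => exact (h 0).exists_lift f hf
    | succ n => exact exists_lift_of_comp_eq_zero h f (by rw [← spliced_d h n]; exact hf)
  obtain ⟨A', π, hπ, x, hx⟩ := surjective_up_to_refinements_of_epi (p (n + 1)) g
  refine ⟨A', π, hπ, x, ?_⟩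
  change π ≫ g ≫ i n = x ≫ (spliced h).d (n + 1) n
  rw [spliced_d]
  exact (reassoc_of% hx) (i n)

/-- A cycle factors through the next syzygy, and then lifts along the epimorphism onto that syzygy.
-/
lemma liftExact_augment_spliced {A : C} (hA : ∀ n (f : A ⟶ K n), ∃ g, g ≫ p n = f) :
    LiftExact ((spliced h).augment (p 0) (spliced_d_comp h)) A := by
  refine ⟨hA 0, fun n f hf => ?_⟩
  obtain ⟨g, rfl⟩ : ∃ g, g ≫ i n = f := by
    cases n with
    | zero => exact (h 0).exists_lift f hf
    | succ n => exact exists_lift_of_comp_eq_zero h f (by rw [← spliced_d h n]; exact hf)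
  obtain ⟨x, rfl⟩ := hA (n + 1) g
  refine ⟨x, ?_⟩
  change x ≫ (spliced h).d (n + 1) n = _
  rw [spliced_d]
  exact (Category.assoc _ _ _).symm

end

/-- Construction of a resolution by choosing syzygies: the `n`th syzygy is to satisfy `S n`, the
`n`th term of the resolution `T n`, and the resolution is to be `Hom(A, -)`-exact for `A` in `V`. -/
lemma exists_resolution {U V : ObjectProperty C} (S T : ℕ → ObjectProperty C) (hT : ∀ n, T n ≤ U)
    (step : ∀ n K, S n K → ∃ (L R : C) (i : L ⟶ R) (p : R ⟶ K), IsShortExact i p ∧ T n R ∧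
      S (n + 1) L ∧ ∀ A, V A → ∀ f : A ⟶ K, ∃ g, g ≫ p = f) {M : C} (hM : S 0 M) :
    ∃ R : Resolution U M, (∀ n, T n (R.complex.X n)) ∧ ∀ A, V A → LiftExact R.augmented A := by
  choose L R i p hS hR hL hp using step
  let syz : ∀ n, { K // S n K } :=
    fun n => Nat.rec ⟨M, hM⟩ (fun n K => ⟨L n K.1 K.2, hL n K.1 K.2⟩) n
  have h n : IsShortExact (A := (syz (n + 1)).1) (i n (syz n).1 (syz n).2)
    (p n (syz n).1 (syz n).2) := hS n _ _
  exact ⟨{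
    complex := spliced h
    mem n := hT n _ (hR n (syz n).1 (syz n).2)
    ε := p 0 M hM
    w := spliced_d_comp h
    exact := acyclic_augment_spliced (p := fun n => p n (syz n).1 (syz n).2) h }, fun n => hR n (syz n).1 (syz n).2,
    fun A hA => liftExact_augment_spliced (p := fun n => p n (syz n).1 (syz n).2) h fun n => hp n (syz n).1 (syz n).2 A hA⟩

end Syzygies

/-! ### The comparison theorem for relative resolutions -/

section Lifts

variable {C : Type u} [Category.{v} C] [Abelian C] {W X : ObjectProperty C} {M : C}

namespace Resolution

/-- The usual inductive construction, with exactness of `P` relative to the terms of `Q` in place of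
projectivity. -/
lemma exists_lift {Q : Resolution W M} {P : Resolution X M}
    (h : ∀ n, LiftExact P.augmented (Q.complex.X n)) : Nonempty (Lift Q P) := by
  obtain ⟨f₀, h₀⟩ : ∃ f₀ : Q.complex.X 0 ⟶ P.complex.X 0, f₀ ≫ P.ε = Q.ε := (h 0).zero Q.ε
  obtain ⟨f₁, h₁⟩ : ∃ f₁ : Q.complex.X 1 ⟶ P.complex.X 1,
      f₁ ≫ P.complex.d 1 0 = Q.complex.d 1 0 ≫ f₀ :=
    (h 1).succ 0 (Q.complex.d 1 0 ≫ f₀) (by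
      change (_ ≫ f₀) ≫ P.ε = 0
      rw [Category.assoc, h₀, Q.w])
  have hs (n : ℕ) (g : Q.complex.X n ⟶ P.complex.X n)
      (g' : Q.complex.X (n + 1) ⟶ P.complex.X (n + 1))
      (w : g' ≫ P.complex.d (n + 1) n = Q.complex.d (n + 1) n ≫ g) :
      ∃ g'' : Q.complex.X (n + 2) ⟶ P.complex.X (n + 2),
        g'' ≫ P.complex.d (n + 2) (n + 1) = Q.complex.d (n + 2) (n + 1) ≫ g' :=
    (h (n + 2)).succ (n + 1) (Q.complex.d (n + 2) (n + 1) ≫ g') (by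
      change (_ ≫ g') ≫ P.complex.d (n + 1) n = 0
      rw [Category.assoc, w, HomologicalComplex.d_comp_d_assoc, zero_comp])
  exact ⟨{
    hom := ChainComplex.mkHom _ _ f₀ f₁ h₁ fun n w =>
      ⟨(hs n w.1 w.2.1 w.2.2).choose, (hs n w.1 w.2.1 w.2.2).choose_spec⟩
    comm := h₀ }⟩

lemma nonempty_homotopy_zero {Q : Resolution W M} {P : Resolution X M}
    (h : ∀ n, LiftExact P.augmented (Q.complex.X n)) (f : Q.complex ⟶ P.complex)
    (hf : f.f 0 ≫ P.ε = 0) : Nonempty (Homotopy f 0) := by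
  obtain ⟨s₀, h₀⟩ : ∃ s₀ : Q.complex.X 0 ⟶ P.complex.X 1, s₀ ≫ P.complex.d 1 0 = f.f 0 :=
    (h 0).succ 0 (f.f 0) hf
  obtain ⟨s₁, h₁⟩ : ∃ s₁ : Q.complex.X 1 ⟶ P.complex.X 2,
      s₁ ≫ P.complex.d 2 1 = f.f 1 - Q.complex.d 1 0 ≫ s₀ :=
    (h 1).succ 1 (f.f 1 - Q.complex.d 1 0 ≫ s₀) (by
      change (_ : Q.complex.X 1 ⟶ P.complex.X 1) ≫ P.complex.d 1 0 = 0
      rw [Preadditive.sub_comp, Category.assoc, h₀, f.comm, sub_self])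
  have hs (n : ℕ) (g : Q.complex.X n ⟶ P.complex.X (n + 1))
      (g' : Q.complex.X (n + 1) ⟶ P.complex.X (n + 2))
      (w : f.f (n + 1) = Q.complex.d (n + 1) n ≫ g + g' ≫ P.complex.d (n + 2) (n + 1)) :
      ∃ g'' : Q.complex.X (n + 2) ⟶ P.complex.X (n + 3),
        g'' ≫ P.complex.d (n + 3) (n + 2) = f.f (n + 2) - Q.complex.d (n + 2) (n + 1) ≫ g' :=
    (h (n + 2)).succ (n + 2) (f.f (n + 2) - Q.complex.d (n + 2) (n + 1) ≫ g') (by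
      change (_ : Q.complex.X (n + 2) ⟶ P.complex.X (n + 2)) ≫ P.complex.d (n + 2) (n + 1) = 0
      rw [Preadditive.sub_comp, Category.assoc, f.comm, w, Preadditive.comp_add,
        HomologicalComplex.d_comp_d_assoc, zero_comp, zero_add, sub_self])
  exact ⟨Homotopy.mkInductive _ s₀ h₀.symm s₁ (by rw [h₁]; abel) fun n w =>
    ⟨(hs n w.1 w.2.1 w.2.2).choose, by rw [(hs n w.1 w.2.1 w.2.2).choose_spec]; abel⟩⟩

end Resolution

namespace Lift

/-- The identity lift. -/
def refl (P : Resolution X M) : Lift P P := ⟨𝟙 _, Category.id_comp _⟩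

/-- Composition of lifts. -/
def trans {Y : ObjectProperty C} {R : Resolution Y M} {Q : Resolution W M} {P : Resolution X M}
    (ψ : Lift R Q) (φ : Lift Q P) : Lift R P :=
  ⟨ψ.hom ≫ φ.hom, by rw [HomologicalComplex.comp_f, Category.assoc, φ.comm, ψ.comm]⟩

end Lift

lemma comparison_refl (P : Resolution X M) (n : ℕ) : comparison (Lift.refl P) n = 𝟙 _ := by
  ext N : 2
  have : (homComplexMap (𝟙 P.complex)).app N = 𝟙 _ := by
    ext k f
    exact Category.id_comp (obj := C) f
  change HomologicalComplex.homologyMap ((homComplexMap (𝟙 P.complex)).app N) n = _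
  rw [this, HomologicalComplex.homologyMap_id]
  rfl

lemma comparison_trans {Y : ObjectProperty C} {R : Resolution Y M} {Q : Resolution W M}
    {P : Resolution X M} (ψ : Lift R Q) (φ : Lift Q P) (n : ℕ) :
    comparison (ψ.trans φ) n = comparison φ n ≫ comparison ψ n := by
  ext N : 2
  have : (homComplexMap (ψ.hom ≫ φ.hom)).app N =
      (homComplexMap φ.hom).app N ≫ (homComplexMap ψ.hom).app N := by
    ext k f
    exact Category.assoc (obj := C) _ _ f
  change HomologicalComplex.homologyMap ((homComplexMap (ψ.hom ≫ φ.hom)).app N) n = _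
  rw [this, HomologicalComplex.homologyMap_comp]
  rfl

lemma comparison_eq {Q : Resolution W M} {P : Resolution X M}
    (h : ∀ n, LiftExact P.augmented (Q.complex.X n)) (φ ψ : Lift Q P) (n : ℕ) :
    comparison φ n = comparison ψ n := by
  obtain ⟨H⟩ := Resolution.nonempty_homotopy_zero h (φ.hom - ψ.hom) (by
    rw [HomologicalComplex.sub_f_apply, Preadditive.sub_comp, φ.comm, ψ.comm, sub_self])
  ext N : 2
  exact ((preadditiveYoneda.obj N).mapHomotopy
    (Homotopy.equivSubZero.symm H).op).homologyMap_eq n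

/-- If there are lifts in both directions between resolutions which are exact relative to their own
terms, then the comparison transformations are isomorphisms. -/
lemma isIso_comparison {Q : Resolution W M} {P : Resolution X M} (φ : Lift Q P) (ψ : Lift P Q)
    (hP : ∀ n, LiftExact P.augmented (P.complex.X n))
    (hQ : ∀ n, LiftExact Q.augmented (Q.complex.X n)) (n : ℕ) :
    IsIso (comparison φ n) := by
  refine ⟨comparison ψ n, ?_, ?_⟩
  · rw [← comparison_trans, ← comparison_refl]
    exact comparison_eq hP _ _ n
  · rw [← comparison_trans, ← comparison_refl]
    exact comparison_eq hQ _ _ n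

end Lifts

end RelHom

namespace RelHom

/-! ### Maps on homology in terms of elements -/

section Homology

universe w

/-- The morphism from the free abelian group of rank one given by an element. -/
def elementHom {G : AddCommGrpCat.{w}} (x : G) : AddCommGrpCat.of (ULift.{w} ℤ) ⟶ G :=
  AddCommGrpCat.ofHom ((zmultiplesHom G x).comp AddEquiv.ulift.toAddMonoidHom)

lemma elementHom_one {G : AddCommGrpCat.{w}} (x : G) : elementHom x (ULift.up (1 : ℤ)) = x :=
  one_zsmul x

lemma elementHom_zero {G : AddCommGrpCat.{w}} : elementHom (0 : G) = 0 := by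
  ext n
  exact zsmul_zero n.down

lemma elementHom_comp {G H : AddCommGrpCat.{w}} (x : G) (f : G ⟶ H) :
    elementHom x ≫ f = elementHom (f x) := by
  ext n
  exact map_zsmul f.hom n.down x

variable {ι : Type*} {c : ComplexShape ι} {K L : HomologicalComplex AddCommGrpCat.{w} c}
  (φ : K ⟶ L) {i j k : ι}

lemma exists_of_epi_homologyMap (hi : c.prev j = i) (hk : c.next j = k)
    (h : Epi (HomologicalComplex.homologyMap φ j)) (y : L.X j) (hy : L.d j k y = 0) :
    ∃ (x : K.X j) (z : L.X i), K.d j k x = 0 ∧ y = φ.f j x + L.d i j z := by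
  rw [HomologicalComplex.epi_homologyMap_iff_up_to_refinements φ i j k hi hk] at h
  -- An element is a generalized element with source `ℤ`. The refinement `π` is surjective, so
  -- evaluating at a preimage of `1` returns to honest elements.
  obtain ⟨A, π, hπ, x, hx, z, hz⟩ := h (elementHom y) (by rw [elementHom_comp, hy, elementHom_zero])
  obtain ⟨a, ha⟩ := (AddCommGrpCat.epi_iff_surjective π).1 hπ ⟨1⟩
  refine ⟨x a, z a, ConcreteCategory.congr_hom hx a, ?_⟩
  have := ConcreteCategory.congr_hom hz a
  rwa [ConcreteCategory.comp_apply, ha, elementHom_one] at this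

lemma exists_of_mono_homologyMap (hi : c.prev j = i) (hk : c.next j = k)
    (h : Mono (HomologicalComplex.homologyMap φ j)) (x : K.X j) (hx : K.d j k x = 0)
    (y : L.X i) (hy : φ.f j x = L.d i j y) : ∃ z : K.X i, x = K.d i j z := by
  rw [HomologicalComplex.mono_homologyMap_iff_up_to_refinements φ i j k hi hk] at h
  obtain ⟨A, π, hπ, z, hz⟩ := h (elementHom x) (by rw [elementHom_comp, hx, elementHom_zero]) (elementHom y)
    (by rw [elementHom_comp, elementHom_comp, hy])
  obtain ⟨a, ha⟩ := (AddCommGrpCat.epi_iff_surjective π).1 hπ ⟨1⟩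
  have := ConcreteCategory.congr_hom hz a
  rw [ConcreteCategory.comp_apply, ha, elementHom_one] at this
  exact ⟨z a, this⟩

end Homology

section ComparisonElements

variable {C : Type u} [Category.{v} C] [Abelian C] {W X : ObjectProperty C} {M : C}
  {Q : Resolution W M} {P : Resolution X M} (φ : Lift Q P)

lemma down_symm_prev (m : ℕ) : (ComplexShape.down ℕ).symm.prev (m + 1) = m :=
  ComplexShape.prev_eq' _ (by simp)

lemma down_symm_next (m : ℕ) : (ComplexShape.down ℕ).symm.next m = m + 1 :=
  ComplexShape.next_eq' _ (by simp)

lemma exists_of_isIso_comparison {m : ℕ} (h : IsIso (comparison φ (m + 1))) {N : C}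
    (q : Q.complex.X (m + 1) ⟶ N) (hq : Q.complex.d (m + 2) (m + 1) ≫ q = 0) :
    ∃ (g : P.complex.X (m + 1) ⟶ N) (k : Q.complex.X m ⟶ N),
      P.complex.d (m + 2) (m + 1) ≫ g = 0 ∧
        q = φ.hom.f (m + 1) ≫ g + Q.complex.d (m + 1) m ≫ k :=
  exists_of_epi_homologyMap ((homComplexMap φ.hom).app N) (down_symm_prev m)
    (down_symm_next (m + 1)) (inferInstanceAs (Epi ((comparison φ (m + 1)).app N))) q hq

lemma exists_eq_d_comp_of_isIso_comparison {m : ℕ} (h : IsIso (comparison φ (m + 1))) {N : C}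
    (p : P.complex.X (m + 1) ⟶ N) (hp : P.complex.d (m + 2) (m + 1) ≫ p = 0)
    (k : Q.complex.X m ⟶ N) (hk : φ.hom.f (m + 1) ≫ p = Q.complex.d (m + 1) m ≫ k) :
    ∃ g : P.complex.X m ⟶ N, p = P.complex.d (m + 1) m ≫ g :=
  exists_of_mono_homologyMap ((homComplexMap φ.hom).app N) (down_symm_prev m)
    (down_symm_next (m + 1)) (inferInstanceAs (Mono ((comparison φ (m + 1)).app N))) p hp k hk

end ComparisonElements

/-! ### The mapping cone of a lift -/

section Cone

variable {C : Type u} [Category.{v} C] [Abelian C]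

section

variable {Q P : ChainComplex C ℕ} (φ : Q ⟶ P)

/-- The objects of the mapping cone. -/
noncomputable def coneX (Q P : ChainComplex C ℕ) : ℕ → C
  | 0 => P.X 0
  | n + 1 => Q.X n ⊞ P.X (n + 1)

/-- The differentials of the mapping cone. -/
noncomputable def coneD : ∀ n, coneX Q P (n + 1) ⟶ coneX Q P n
  | 0 => (biprod.desc (φ.f 0) (P.d 1 0) : Q.X 0 ⊞ P.X 1 ⟶ P.X 0)
  | n + 1 => (biprod.desc (biprod.lift (-Q.d (n + 1) n) (φ.f (n + 1)))
      (biprod.lift 0 (P.d (n + 2) (n + 1))) : Q.X (n + 1) ⊞ P.X (n + 2) ⟶ Q.X n ⊞ P.X (n + 1))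

lemma coneD_comp : ∀ n, coneD φ (n + 1) ≫ coneD φ n = 0
  | 0 => by
    change (biprod.desc _ _ : _ ⊞ _ ⟶ _ ⊞ _) ≫ biprod.desc _ _ = (0 : Q.X 1 ⊞ P.X 2 ⟶ P.X 0)
    ext <;> simp
  | n + 1 => by
    change (biprod.desc _ _ : _ ⊞ _ ⟶ _ ⊞ _) ≫ (biprod.desc _ _ : _ ⊞ _ ⟶ _ ⊞ _) =
      (0 : Q.X (n + 2) ⊞ P.X (n + 3) ⟶ Q.X n ⊞ P.X (n + 1))
    ext <;> simp

/-- The mapping cone of a morphism of nonnegatively graded chain complexes. -/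
noncomputable def cone : ChainComplex C ℕ := ChainComplex.of (coneX Q P) (coneD φ) (coneD_comp φ)

lemma cone_d (n : ℕ) : (cone φ).d (n + 1) n = coneD φ n :=
  ChainComplex.of_d (coneX Q P) (coneD φ) n

end

variable {W X : ObjectProperty C} {M : C}

namespace Resolution

lemma epi_ε (P : Resolution X M) : Epi P.ε := ((acyclic_iff _).1 P.exact).1

lemma exact_zero (P : Resolution X M) : (ShortComplex.mk (P.complex.d 1 0) P.ε P.w).Exact :=
  ((acyclic_iff _).1 P.exact).2 0

lemma exact_succ (P : Resolution X M) (n : ℕ) :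
    (ShortComplex.mk (P.complex.d (n + 2) (n + 1)) (P.complex.d (n + 1) n) (by simp)).Exact :=
  ((acyclic_iff _).1 P.exact).2 (n + 1)

end Resolution

variable {Q : Resolution W M} {P : Resolution X M} (φ : Lift Q P)

/-- The mapping cone of a lift of the identity is exact. -/
lemma acyclic_cone : (cone φ.hom).Acyclic := by
  have := Q.epi_ε
  -- Once the `Q`-component of a cone cycle bounds some `q'`, the corrected component `p + q' ≫ φ`
  -- is a cycle of `P`, hence a boundary. Only the hypothesis on `q` depends on whether the degree
  -- is zero, where the augmentation enters.
  have key (n : ℕ) {A : C} (q : A ⟶ Q.complex.X n) (p : A ⟶ P.complex.X (n + 1))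
      (hq : ∃ (A' : C) (π : A' ⟶ A) (_ : Epi π) (q' : A' ⟶ Q.complex.X (n + 1)),
        π ≫ q = q' ≫ Q.complex.d (n + 1) n)
      (hp : q ≫ φ.hom.f n + p ≫ P.complex.d (n + 1) n = 0) :
      ∃ (A' : C) (π : A' ⟶ A) (_ : Epi π) (x : A' ⟶ Q.complex.X (n + 1) ⊞ P.complex.X (n + 2)),
        π ≫ biprod.lift q p = x ≫ coneD φ.hom (n + 1) := by
    obtain ⟨A₁, π₁, _, q', hq'⟩ := hq
    obtain ⟨A₂, π₂, _, p', hp'⟩ := (P.exact_succ n).exact_up_to_refinements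
      (π₁ ≫ p + q' ≫ φ.hom.f (n + 1)) (by
        dsimp only
        rw [Preadditive.add_comp, Category.assoc, Category.assoc, φ.hom.comm, ← reassoc_of% hq',
          ← Preadditive.comp_add, add_comm, hp, comp_zero])
    dsimp only at hp'
    refine ⟨A₂, π₂ ≫ π₁, inferInstance, biprod.lift (-(π₂ ≫ q')) p', ?_⟩
    change _ = _ ≫ (biprod.desc _ _ : _ ⊞ _ ⟶ _ ⊞ _)
    ext
    · simp [hq']
    · simp only [Category.assoc, biprod.lift_snd, biprod.lift_desc, Preadditive.neg_comp,
        Preadditive.add_comp, ← hp', Preadditive.comp_add]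
      abel
  refine (acyclic_iff _).2 ⟨?_, fun n => ?_⟩
  · suffices h : Epi (biprod.desc (φ.hom.f 0) (P.complex.d 1 0)) by
      rw [cone_d]
      exact h
    rw [epi_iff_surjective_up_to_refinements]
    intro A y
    obtain ⟨A₁, π₁, _, q, hq⟩ := surjective_up_to_refinements_of_epi Q.ε (y ≫ P.ε)
    obtain ⟨A₂, π₂, _, p, hp⟩ := P.exact_zero.exact_up_to_refinements
      (π₁ ≫ y - q ≫ φ.hom.f 0) (by
        dsimp only
        rw [Preadditive.sub_comp, Category.assoc, Category.assoc, hq, φ.comm, sub_self])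
    refine ⟨A₂, π₂ ≫ π₁, inferInstance, biprod.lift (π₂ ≫ q) p, ?_⟩
    dsimp only at hp
    rw [biprod.lift_desc, ← hp, Preadditive.comp_sub, Category.assoc, Category.assoc]
    exact (add_sub_cancel _ _).symm
  · rw [ShortComplex.exact_iff_exact_up_to_refinements]
    intro A f hf
    simp only [cone_d] at hf ⊢
    change A ⟶ Q.complex.X n ⊞ P.complex.X (n + 1) at f
    obtain ⟨q, p, rfl⟩ : ∃ q p, f = biprod.lift q p :=
      ⟨f ≫ biprod.fst, f ≫ biprod.snd, by ext <;> simp⟩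
    cases n with
    | zero =>
      replace hf : q ≫ φ.hom.f 0 + p ≫ P.complex.d 1 0 = 0 := (biprod.lift_desc ..).symm.trans hf
      refine key 0 q p (Q.exact_zero.exact_up_to_refinements q ?_) hf
      change q ≫ Q.ε = 0
      rw [← φ.comm, ← Category.assoc, eq_neg_of_add_eq_zero_left hf, Preadditive.neg_comp,
        Category.assoc, P.w, comp_zero, neg_zero]
    | succ n =>
      replace hf : biprod.lift q p ≫ (biprod.desc (biprod.lift (-Q.complex.d (n + 1) n)
        (φ.hom.f (n + 1))) (biprod.lift 0 (P.complex.d (n + 2) (n + 1))) :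
          _ ⟶ Q.complex.X n ⊞ P.complex.X (n + 1)) = 0 := hf
      rw [biprod.lift_desc] at hf
      refine key (n + 1) q p ((Q.exact_succ n).exact_up_to_refinements q ?_) ?_
      · simpa using hf =≫ biprod.fst
      · simpa using hf =≫ biprod.snd

/-- The condition on two consecutive comparison maps making the mapping cone `Hom(-, N)`-exact. -/
lemma exists_eq_cone_d_comp {m : ℕ} (h : IsIso (comparison φ (m + 1)))
    (h' : IsIso (comparison φ (m + 2)) ∨ IsZero (P.complex.X (m + 2))) {N : C}
    (f : (cone φ.hom).X (m + 2) ⟶ N) (hf : (cone φ.hom).d (m + 3) (m + 2) ≫ f = 0) :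
    ∃ g, f = (cone φ.hom).d (m + 2) (m + 1) ≫ g := by
  rw [cone_d] at hf ⊢
  change Q.complex.X (m + 1) ⊞ P.complex.X (m + 2) ⟶ N at f
  obtain ⟨q, p, rfl⟩ : ∃ q p, f = biprod.desc q p :=
    ⟨biprod.inl ≫ f, biprod.inr ≫ f, by ext <;> simp⟩
  replace hf : (biprod.desc (biprod.lift (-Q.complex.d (m + 2) (m + 1))
      (φ.hom.f (m + 2))) (biprod.lift 0 (P.complex.d (m + 3) (m + 2))) :
      _ ⟶ Q.complex.X (m + 1) ⊞ P.complex.X (m + 2)) ≫ biprod.desc q p = 0 := hf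
  have h₁ : φ.hom.f (m + 2) ≫ p = Q.complex.d (m + 2) (m + 1) ≫ q := by
    have := biprod.inl ≫= hf
    simp only [biprod.inl_desc_assoc, biprod.lift_desc, Preadditive.neg_comp, comp_zero] at this
    rwa [neg_add_eq_zero, eq_comm] at this
  have h₂ : P.complex.d (m + 3) (m + 2) ≫ p = 0 := by
    simpa using biprod.inr ≫= hf
  -- By `h₁` the class of `p` dies in the cohomology of `Hom(Q, N)`; injectivity in degree `m + 2`
  -- makes `p` a coboundary.
  obtain ⟨l, hl⟩ : ∃ l : P.complex.X (m + 1) ⟶ N, p = P.complex.d (m + 2) (m + 1) ≫ l := by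
    obtain h' | h' := h'
    · exact exists_eq_d_comp_of_isIso_comparison φ h' p h₂ q h₁
    · exact ⟨0, h'.eq_of_src _ _⟩
  -- Subtracting the contribution of `l` turns `q` into a cocycle, to which surjectivity in degree
  -- `m + 1` applies.
  obtain ⟨g, k, hg, hk⟩ := exists_of_isIso_comparison φ h (q - φ.hom.f (m + 1) ≫ l) (by
    rw [Preadditive.comp_sub, ← h₁, ← φ.hom.comm_assoc, ← hl, sub_self])
  refine ⟨(biprod.desc (-k) (l + g) : Q.complex.X m ⊞ P.complex.X (m + 1) ⟶ N), ?_⟩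
  change _ = (biprod.desc _ _ : _ ⊞ _ ⟶ _ ⊞ _) ≫ biprod.desc _ _
  ext
  · rw [sub_eq_iff_eq_add] at hk
    simp [hk]
    abel
  · simp [hl, hg]

end Cone

end RelHom

namespace RelHom

/-! ### Projective dimension and finite resolutions -/

section Dimension

variable {C : Type u} [Category.{v} C] [Abelian C] {U : ObjectProperty C} {M : C}

lemma Resolution.length_le_iff (R : Resolution U M) (n : ℕ) :
    R.length ≤ n ↔ ∀ k, n < k → IsZero (R.complex.X k) := by
  simp only [Resolution.length, iSup_le_iff, Nat.cast_le]
  exact forall_congr' fun k => by rw [not_imp_comm, not_le]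

lemma Hat.of_resolution (hU : IsSubcategory U) (R : Resolution U M) {n : ℕ}
    (h : R.length ≤ n) : Hat U n M := by
  rw [Resolution.length_le_iff] at h
  have hS := isShortExact_of_acyclic R.exact
  suffices H : ∀ k j, j + k = n → Hat U k (image (R.augmented.d (j + 1) j)) by
    have : Epi (R.augmented.d 1 0) := ((acyclic_iff _).1 R.exact).1
    have : Epi (image.ι (R.augmented.d 1 0)) := epi_of_epi_fac (image.fac (R.augmented.d 1 0))
    have := isIso_of_mono_of_epi (image.ι (R.augmented.d 1 0))
    exact (H n 0 (zero_add n)).of_iso hU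
      (asIso (image.ι (R.augmented.d 1 0)) : _ ≅ R.augmented.X 0)
  intro k
  induction k with
  | zero =>
    rintro j rfl
    -- Augmentation shifts degrees by one: term `j + 2` here is term `j + 1` of `R`, beyond the
    -- length `j`.
    have hz : R.augmented.d (j + 2) (j + 1) = 0 :=
      IsZero.eq_of_src (h (j + 1) (by lia)) _ _
    have : Mono (factorThruImage (R.augmented.d (j + 1) j)) := by
      have hz' : image.ι (R.augmented.d (j + 2) (j + 1)) = 0 := by
        rw [← cancel_epi (factorThruImage _), image.fac, hz, comp_zero]
      exact (hS j).2.exact.mono_g hz'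
    have := isIso_of_mono_of_epi (factorThruImage (R.augmented.d (j + 1) j))
    have := hU.isoClosed
    exact U.prop_of_iso (asIso (factorThruImage (R.augmented.d (j + 1) j))) (R.mem j)
  | succ k ih =>
    rintro j hj
    exact ⟨_, _, _, _, hS j, R.mem j, ih (j + 1) (by lia)⟩

lemma Hat.of_projDim_eq (hU : IsSubcategory U) {n : ℕ} (h : projDim U M = n) :
    Hat U n M := by
  have : Nonempty (Resolution U M) := by
    by_contra! hM
    rw [projDim, iInf_of_empty] at h
    exact ENat.top_ne_natCast n h
  obtain ⟨R, hR⟩ := ENat.exists_eq_iInf fun R : Resolution U M => R.length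
  exact .of_resolution hU R (hR.trans h).le

end Dimension

/-! ### Resolutions with prescribed terms and exactness -/

section SpecialResolutions

variable {C : Type u} [Category.{v} C] [Abelian C] {W X : ObjectProperty C} {M : C}

lemma exists_resolution_of_perp (hWX : Perp X W) (hW : IsSubcategory W) {n : ℕ}
    (hM : Hat W n M) : ∃ R : Resolution W M, ∀ A, X A → LiftExact R.augmented A := by
  refine (exists_resolution (V := X) (fun _ K => ∃ k, Hat W k K) (fun _ => W)
    (fun _ => le_rfl) ?_ ⟨n, hM⟩).imp fun R hR => hR.2
  rintro - K ⟨k, hK⟩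
  -- Raising the bound provides a short exact sequence even when `k = 0`.
  obtain ⟨L, R, i, p, hS, hR, hL⟩ := hK.succ hW
  exact ⟨L, R, i, p, hS, hR, ⟨_, hL⟩, fun A hA f => (hWX.hat k).exists_lift hS hA hL f⟩

lemma exists_isProper_resolution (hXs : IsSubcategory X) (hX : X.IsClosedUnderExtensions)
    (hgen : IsGeneratorFor W X) (hWX : Perp W X) {n : ℕ} (hM : Hat X n M) :
    ∃ R : Resolution W M, R.IsProper := by
  refine (exists_resolution (V := W) (fun _ K => Hat X n K) (fun _ => W)
    (fun _ => le_rfl) ?_ hM).imp fun R hR => R.isProper_iff.2 hR.2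
  intro _ K hK
  obtain ⟨L, R, i, p, hS, hR, hL⟩ := hK.exists_cover hXs hX hgen
  exact ⟨L, R, i, p, hS, hR, hL, fun A hA f => (hWX.hat n).exists_lift hS hA hL f⟩

/-- An object with a finite `X`-resolution has a proper one, of the same length, whose terms in
positive degrees belong to `W`. -/
lemma exists_special_resolution (hWs : IsSubcategory W) (hle : W ≤ X)
    (hX : X.IsClosedUnderExtensions) (hcogen : IsCogeneratorFor W X) (hXW : Perp X W) {d : ℕ}
    (hM : Hat X d M) :
    ∃ R : Resolution X M, R.IsProper ∧ R.length ≤ d ∧ ∀ n, W (R.complex.X (n + 1)) := by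
  -- After the initial approximation, syzygy `n + 1` has a `W`-resolution of length `d - (n + 1)`.
  -- Once this budget is exhausted, all further syzygies are zero.
  let S : ℕ → ObjectProperty C := fun n K => match n with
    | 0 => Hat X d K
    | n + 1 => (∃ k, n + k + 1 = d ∧ Hat W k K) ∨ IsZero K
  let T : ℕ → ObjectProperty C := fun n R => match n with
    | 0 => X R
    | n + 1 => W R ∧ (n + 1 ≤ d ∨ IsZero R)
  have trivial_step (K : C) : ∃ L : C, IsZero L ∧ IsShortExact (0 : L ⟶ K) (𝟙 K) ∧
      ∀ (A : C) (f : A ⟶ K), ∃ g, g ≫ 𝟙 K = f :=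
    ⟨_, isZero_zero C, .zero_id _ _ (isZero_zero C), fun A f => ⟨f, Category.comp_id f⟩⟩
  refine (exists_resolution (U := X) (V := X) S T ?_ ?_ hM).imp fun R ⟨hT, hR⟩ => ?_
  rotate_right
  · refine ⟨ R.isProper_iff.2 hR, (R.length_le_iff d).2 fun k hk => ?_, fun n => (hT (n + 1)).1⟩
    obtain _ | k := k
    · lia
    · exact (hT (k + 1)).2.resolve_left (by lia)
  · rintro (_ | n) R hR
    · exact hR
    · exact hle _ hR.1
  · rintro (_ | n) K hK
    · obtain _ | d := d
      · obtain ⟨L, hL, hS, hl⟩ := trivial_step K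
        exact ⟨L, K, _, _, hS, hK, Or.inr hL, fun A _ => hl A⟩
      · obtain ⟨L, R, i, p, hS, hL, hR⟩ := (Hat.exists_hull_and_approximation hX hcogen d).2 K hK
        exact ⟨L, R, i, p, hS, hR, Or.inl ⟨d, by lia, hL⟩,
          fun A hA f => (hXW.hat d).exists_lift hS hA hL f⟩
    · obtain ⟨k, hk, hK⟩ | hK := hK
      · obtain _ | k := k
        · obtain ⟨L, hL, hS, hl⟩ := trivial_step K
          exact ⟨L, K, _, _, hS, ⟨hK, Or.inl (by lia)⟩, Or.inr hL, fun A _ => hl A⟩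
        · obtain ⟨L, R, i, p, hS, hR, hL⟩ := hK
          exact ⟨L, R, i, p, hS, ⟨hR, Or.inl (by lia)⟩, Or.inl ⟨k, by lia, hL⟩,
            fun A hA f => (hXW.hat k).exists_lift hS hA hL f⟩
      · obtain ⟨L, hL, hS, hl⟩ := trivial_step K
        exact ⟨L, K, _, _, hS, ⟨hWs.prop_of_isZero hK, Or.inr hK⟩, Or.inr hL, fun A _ => hl A⟩

end SpecialResolutions

/-! ### Descent of membership in `W` along syzygies -/

section Descent

variable {C : Type u} [Category.{v} C] [Abelian C] {W X : ObjectProperty C}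

/-- If `E` is an exact complex of objects of `X`, with positive terms in `W`, which splits in some
degree, then its last term belongs to `W`. -/
lemma prop_of_acyclic (hXs : IsSubcategory X) (hXker : ClosedUnderKernelsOfEpis X) (hle : W ≤ X)
    (hWsub : IsSubcategory W) (hWsum : ClosedUnderSummands W) (hXW : Perp X W)
    {E : ChainComplex C ℕ} (hE : E.Acyclic) (hE₀ : X (E.X 0)) (hEW : ∀ n, W (E.X (n + 1))) {m : ℕ}
    (hm : ∀ (N : C) (f : E.X (m + 2) ⟶ N), E.d (m + 3) (m + 2) ≫ f = 0 →
      ∃ g, f = E.d (m + 2) (m + 1) ≫ g) : W (E.X 0) := by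
  have := hXs.isoClosed
  have := hWsub.isoClosed
  have : W.IsStableUnderRetracts := hWsum
  have hS := isShortExact_of_acyclic hE
  have : Epi (E.d 1 0) := ((acyclic_iff _).1 hE).1
  have : Epi (image.ι (E.d 1 0)) := epi_of_epi_fac (image.fac (E.d 1 0))
  have := isIso_of_mono_of_epi (image.ι (E.d 1 0))
  let e : image (E.d 1 0) ≅ E.X 0 := asIso (image.ι (E.d 1 0))
  have hX : ∀ j, X (image (E.d (j + 1) j)) := fun j => by
    induction j with
    | zero => exact X.prop_of_iso e.symm hE₀
    | succ j ih => exact hXker _ (hS j).2 (hle _ (hEW j)) ih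
  have top : W (image (E.d (m + 2) (m + 1))) := by
    -- Applied to the projection onto the syzygy, `Hom(-, N)`-exactness yields a retraction of the
    -- inclusion of that syzygy into `E.X (m + 1)`.
    obtain ⟨g, hg⟩ := hm _ (factorThruImage (E.d (m + 2) (m + 1))) (by
      rw [← cancel_mono (image.ι _), Category.assoc, image.fac, E.d_comp_d, zero_comp])
    refine W.prop_of_retract ⟨image.ι (E.d (m + 2) (m + 1)), g, ?_⟩ (hEW m)
    rw [← cancel_epi (factorThruImage (E.d (m + 2) (m + 1))), image.fac_assoc, ← hg,
      Category.comp_id]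
  have descend : ∀ k j, j + k = m + 1 → W (image (E.d (j + 1) j)) := fun k => by
    induction k with
    | zero =>
      rintro j rfl
      exact top
    | succ k ih =>
      rintro j hj
      -- The quotient syzygy is in `X` and the kernel in `W`, so the sequence splits and the
      -- quotient is a summand of a term in `W`.
      obtain ⟨s, hs⟩ := hXW.exists_lift (hS j) (hX j) (ih (j + 1) (by lia)) (𝟙 _)
      exact W.prop_of_retract ⟨s, _, hs⟩ (hEW j)
  exact W.prop_of_iso e (descend (m + 1) 0 (zero_add _))

end Descent

end RelHom

/-! ### The equivalence -/

theorem corollary5p6 {C : Type u} [Category.{v} C] [Abelian C]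
    (X W : ObjectProperty C)
    (hXsub : RelHom.IsSubcategory X) (hWsub : RelHom.IsSubcategory W) (hWX : W ≤ X)
    (hXexact : RelHom.IsExactSubcategory X)
    (hXker : RelHom.ClosedUnderKernelsOfEpis X)
    (hWsum : RelHom.ClosedUnderSummands W)
    (hWker : RelHom.ClosedUnderKernelsOfEpis W)
    (hWinj : RelHom.IsInjectiveCogeneratorFor W X)
    (hWproj : RelHom.IsProjectiveGeneratorFor W X)
    (M : C) (d : ℕ) (hd : RelHom.projDim X M = (d : ℕ∞)) :
    -- proper resolutions of `M` exist, so the comparison transformations are defined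
    (∃ P : RelHom.Resolution X M, P.IsProper) ∧
    (∃ Q : RelHom.Resolution W M, Q.IsProper) ∧
    ∀ (P : RelHom.Resolution X M) (Q : RelHom.Resolution W M), P.IsProper → Q.IsProper →
      Nonempty (RelHom.Lift Q P) ∧
      ∀ φ : RelHom.Lift Q P,
        List.TFAE
          [RelHom.projDim W M < ⊤,
           ∀ i : ℕ, IsIso (RelHom.comparison φ i),
           (∃ i : ℕ, 1 ≤ i ∧ i + 1 < d ∧
              IsIso (RelHom.comparison φ i) ∧ IsIso (RelHom.comparison φ (i + 1))) ∨
            (∃ i : ℕ, 1 ≤ i ∧ d ≤ i ∧ IsIso (RelHom.comparison φ i))] := by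
  have hXext := hXexact.extensions
  have hXM : RelHom.Hat X d M := .of_projDim_eq hXsub hd
  obtain ⟨P', hP', hP'd, hP'W⟩ := RelHom.exists_special_resolution hWsub hWX hXext
    hWinj.cogenerator hWinj.perp hXM
  refine ⟨⟨P', hP'⟩, RelHom.exists_isProper_resolution hXsub hXext hWproj.generator hWproj.perp hXM,
    fun P Q hP hQ => ?_⟩
  rw [RelHom.Resolution.isProper_iff] at hP hQ hP'
  refine ⟨RelHom.Resolution.exists_lift fun n => hP _ (hWX _ (Q.mem n)), fun φ => ?_⟩
  tfae_have 1 → 2 := by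
    intro h i
    obtain ⟨m, hm⟩ := ENat.ne_top_iff_exists.1 h.ne
    obtain ⟨R, hR⟩ := RelHom.exists_resolution_of_perp hWinj.perp hWsub
      (RelHom.Hat.of_projDim_eq hWsub hm.symm)
    obtain ⟨α⟩ := RelHom.Resolution.exists_lift fun n => hR _ (P.mem n)
    obtain ⟨β⟩ := RelHom.Resolution.exists_lift fun n => hQ _ (R.mem n)
    exact RelHom.isIso_comparison φ (α.trans β) (fun n => hP _ (P.mem n))
      (fun n => hQ _ (Q.mem n)) i
  -- Degree `d` itself would fail `1 ≤ i` when `d = 0`.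
  tfae_have 2 → 3 := fun h => Or.inr ⟨d + 1, by lia, by lia, h _⟩
  tfae_have 3 → 1 := by
    intro h
    obtain ⟨β⟩ := RelHom.Resolution.exists_lift fun n => hP' _ (P.mem n)
    obtain ⟨γ⟩ := RelHom.Resolution.exists_lift fun n => hP _ (P'.mem n)
    have hβ (i : ℕ) (hi : IsIso (RelHom.comparison φ i)) :
        IsIso (RelHom.comparison (φ.trans β) i) := by
      have := RelHom.isIso_comparison β γ (fun n => hP' _ (P'.mem n)) (fun n => hP _ (P.mem n)) i
      rw [RelHom.comparison_trans]
      infer_instance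
    -- Here `i = m + 1`. When `d ≤ i`, the term of `P'` in degree `m + 2` vanishes, which replaces
    -- the condition on the second comparison map.
    obtain ⟨m, hm, hm'⟩ : ∃ m : ℕ, IsIso (RelHom.comparison (φ.trans β) (m + 1)) ∧
        (IsIso (RelHom.comparison (φ.trans β) (m + 2)) ∨ IsZero (P'.complex.X (m + 2))) := by
      obtain ⟨_ | m, h₁, -, h, h'⟩ | ⟨_ | m, h₁, h₂, h⟩ := h
      · lia
      · exact ⟨m, hβ _ h, Or.inl (hβ _ h')⟩
      · lia
      · exact ⟨m, hβ _ h, Or.inr ((P'.length_le_iff d).1 hP'd _ (by lia))⟩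
    have hW₀ : W (P'.complex.X 0) := RelHom.prop_of_acyclic hXsub hXker hWX hWsub hWsum hWinj.perp
      (E := RelHom.cone (φ.trans β).hom) (RelHom.acyclic_cone (φ.trans β)) (P'.mem 0)
      (fun n => hWsub.biprod _ _ (Q.mem n) (hP'W n))
      (fun N f hf => RelHom.exists_eq_cone_d_comp (φ.trans β) hm hm' f hf)
    let R : RelHom.Resolution W M :=
      { complex := P'.complex
        mem := fun n => by cases n with | zero => exact hW₀ | succ n => exact hP'W n
        ε := P'.ε
        w := P'.w
        exact := P'.exact }
    exact (iInf_le _ R).trans_lt (hP'd.trans_lt (ENat.natCast_lt_top d))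
  tfae_finish
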